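/- Let $S$ be the set of finite binary strings and $\Omega=\{0,1\}^{\mathbb N}$ the space of infinite binary sequences with the $\sigma$-algebra generated by the cylinders $\Delta(x)=\{x\omega:\omega\in\Omega\}$, $x\in S$; for $A\subseteq S$ put $\tilde A=\bigcup_{x\in A}\Delta(x)$. A probability measure $P$ on $\Omega$ is called computable if there is a computable function $p:S\times\mathbb N\to\mathbb Q$ with $|P(\Delta(x))-p(x,k)|<1/k$ for all $x\in S$ and all integers $k\ge 1$. A (Martin-Löf) test with respect to $P$ is a recursively enumerable set $U\subseteq\mathbb N\times S$ such that, with $U_n=\{x:(n,x)\in U\}$, one has $\tilde U_{n+1}\subseteq\tilde U_n$ and $P(\tilde U_n)<2^{-n}$ for all $n$. A test $U$ is universal if for every test $V$ with respect to $P$ there is a constant $c$ with $\tilde V_{n+c}\subseteq\tilde U_n$ for all $n$. For computable $P$ a universal test $U$ exists, and the set of random sequences with respect to $P$ is $\mathcal R^P=\big(\bigcap_{n\ge1}\tilde U_n\big)^c$, which does not depend on the choice of $U$. **Theorem.** Let $P$ and $Q$ be computable probability measures on $\Omega$. Then $\mathcal R^P\cap\mathcal R^Q=\emptyset$ if and only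 if $P$ and $Q$ are mutually singular, i.e. there are disjoint measurable sets $A,B\subseteq\Omega$ with $P(A)=1$ and $Q(B)=1$. -/

import Mathlib

open MeasureTheory

namespace MLRandom

/-- The space `Ω` of infinite binary sequences. Its (product) measurable structure is the
`σ`-algebra generated by the cylinders `Δ(x)`. Finite binary strings are `List Bool`. -/
abbrev Seq : Type := ℕ → Bool

/-- The cylinder `Δ(x) = {xω : ω ∈ Ω}` of all infinite sequences that extend the string `x`. -/
def cyl (x : List Bool) : Set Seq :=
  {ω | ∀ (i : ℕ) (h : i < x.length), ω i = x[i]}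

/-- The set `Ã = ⋃_{x ∈ A} Δ(x)` covered by a set `A` of strings. -/
def cover (A : Set (List Bool)) : Set Seq :=
  ⋃ x ∈ A, cyl x

/-- `P` is computable: there is a computable rational-valued function `(x, k) ↦ p(x, k)` such that
`|P(Δ(x)) - p(x, k)| < 1 / k` for all strings `x` and all positive integers `k`.
The pair `(a, b) : ℤ × ℕ` is the code of the rational number `a / (b + 1)`. -/
def IsComputable (P : Measure Seq) : Prop :=
  ∃ p : List Bool → ℕ → ℤ × ℕ, Computable₂ p ∧
    ∀ (x : List Bool) (k : ℕ), 0 < k →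
      |P.real (cyl x) - ((p x k).1 : ℝ) / (((p x k).2 : ℝ) + 1)| < 1 / (k : ℝ)

/-- The section `U_n = {x : (n, x) ∈ U}`. -/
def level (U : Set (ℕ × List Bool)) (n : ℕ) : Set (List Bool) :=
  {x | (n, x) ∈ U}

/-- `U` is a Martin-Löf test with respect to `P`. -/
structure IsTest (P : Measure Seq) (U : Set (ℕ × List Bool)) : Prop where
  re : REPred fun q : ℕ × List Bool => q ∈ U
  antitone : ∀ n : ℕ, cover (level U (n + 1)) ⊆ cover (level U n)
  measure_lt : ∀ n : ℕ, P.real (cover (level U n)) < (1 / 2 : ℝ) ^ n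

/-- `U` is a universal Martin-Löf test with respect to `P`. -/
structure IsUniversalTest (P : Measure Seq) (U : Set (ℕ × List Bool)) : Prop where
  isTest : IsTest P U
  dominates : ∀ V : Set (ℕ × List Bool), IsTest P V →
    ∃ c : ℕ, ∀ n : ℕ, cover (level V (n + c)) ⊆ cover (level U n)

/-- The limit `⋂_{n ≥ 1} Ũ_n` of a test. -/
def testLimit (U : Set (ℕ × List Bool)) : Set Seq :=
  ⋂ (n : ℕ) (_ : 1 ≤ n), cover (level U n)

/-- The set `R^P` of random sequences with respect to `P`: the complement of the limit of a
universal test. By `randomSet_eq` it does not depend on the universal test. -/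
def randomSet (P : Measure Seq) : Set Seq :=
  {ω | ∃ U : Set (ℕ × List Bool), IsUniversalTest P U ∧ ω ∈ (testLimit U)ᶜ}

theorem testLimit_subset {P : Measure Seq} {U V : Set (ℕ × List Bool)}
    (hU : IsUniversalTest P U) (hV : IsTest P V) : testLimit V ⊆ testLimit U := by
  obtain ⟨c, hc⟩ := hU.dominates V hV
  intro ω hω
  simp only [testLimit, Set.mem_iInter] at hω ⊢
  exact fun n hn => hc n (hω (n + c) (by omega))

theorem randomSet_eq {P : Measure Seq} {U : Set (ℕ × List Bool)} (hU : IsUniversalTest P U) :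
    randomSet P = (testLimit U)ᶜ := by
  ext ω
  constructor
  · rintro ⟨V, hV, h⟩ h'
    exact h (testLimit_subset hV hU.isTest h')
  · exact fun h => ⟨U, hU, h⟩

end MLRandom

/-! If no sequence is random for both measures, take universal tests for `P` and `Q`. The limit of
the first is `P`-null, and its complement, the set of `P`-random sequences, lies in the limit of the
second, which is `Q`-null. This needs universal tests to exist (`isUniversalTest_universalTest`):
all r.e. sets are enumerated by clopen stages, each is cut off before its measure becomes too large,
and the results are united.

Conversely, regularity gives clopen sets `C n` with `P (C n)` and `Q (C n)ᶜ` below `2 ^ (-(n + 2))`.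
For computable measures, a strict upper bound on a clopen set has a finite certificate
(`UpperApprox.measureReal_clopen_lt_iff`), so an unbounded search finds `C n` computably. By an
effective Borel–Cantelli argument the tails `⋃ i, C (n + i)` form a `P`-test and the tails of the
complements a `Q`-test. Each sequence lies in infinitely many `C n` or in almost all complements, so
it fails one of the two tests. -/

/-! ### Computability: list sums, unbounded search, arithmetic. -/

theorem Computable.list_sum_map {α β : Type*} [Primcodable α] [Primcodable β]
    {f : α → List β} {g : α → β → ℕ} (hf : Computable f) (hg : Computable₂ g) :
    Computable fun a => ((f a).map (g a)).sum := by
  have hstep : Computable₂ fun (a : α) (q : ℕ × ℕ) =>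
      q.2 + (((f a)[q.1]?).map (g a)).getD 0 := by
    refine (Primrec.nat_add.to_comp).comp (Computable.snd.comp Computable.snd) ?_
    refine Computable.option_getD ?_ (Computable.const 0)
    refine Computable.option_map ?_ ?_
    · exact Computable.list_getElem?.comp (hf.comp Computable.fst)
        (Computable.fst.comp Computable.snd)
    · exact hg.comp (Computable.fst.comp Computable.fst) Computable.snd
  refine (Computable.nat_rec (Computable.list_length.comp hf) (Computable.const 0) hstep).of_eq ?_
  intro a
  -- The index stays below the length, so the default value `0` is never used.
  have key : ∀ (l : List β) (n : ℕ), n ≤ l.length →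
      Nat.rec (motive := fun _ => ℕ) 0 (fun i s => s + ((l[i]?).map (g a)).getD 0) n
        = ((l.take n).map (g a)).sum := by
    intro l n
    induction n with
    | zero => simp
    | succ n ih =>
      intro hn
      have h : n < l.length := hn
      simp only [ih h.le, List.take_add_one, List.getElem?_eq_getElem h,
        List.map_append, List.sum_append]
      simp
  have := key (f a) _ le_rfl
  simpa using this

theorem Primrec.int_toNat : Primrec Int.toNat := by
  -- The coding of `ℤ` puts nonnegative integers at even codes and negative ones at odd codes.
  have h : Primrec fun z : ℤ => if Encodable.encode z % 2 = 0 then Encodable.encode z / 2 else 0 :=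
    Primrec.ite
      (Primrec.eq.comp (Primrec.nat_mod.comp Primrec.encode (Primrec.const 2)) (Primrec.const 0))
      (Primrec.nat_div.comp Primrec.encode (Primrec.const 2)) (Primrec.const 0)
  refine h.of_eq fun z => ?_
  cases z with
  | ofNat n =>
    have : Encodable.encode (Int.ofNat n) = 2 * n := rfl
    rw [this]; simp
  | negSucc n =>
    have : Encodable.encode (Int.negSucc n) = 2 * n + 1 := rfl
    rw [this, if_neg (by omega)]; simp

/-- Unbounded search for a witness in an encodable type. -/
theorem Computable₂.exists_partrec_search {α β : Type*} [Primcodable α] [Primcodable β]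
    {b : α → β → Bool} (hb : Computable₂ b) :
    ∃ f : α →. β, Partrec f ∧ (∀ a, (f a).Dom ↔ ∃ w, b a w = true) ∧
      ∀ a, ∀ w ∈ f a, b a w = true := by
  let g : α → ℕ → Option β := fun a n =>
    (Encodable.decode (α := β) n).bind fun w => cond (b a w) (some w) none
  have hg : Computable₂ g := by
    refine Computable.option_bind (Computable.decode.comp Computable.snd) ?_
    exact Computable.cond (hb.comp (Computable.fst.comp Computable.fst) Computable.snd)
      (Computable.option_some.comp Computable.snd) (Computable.const none)
  have hmem : ∀ a n w, w ∈ g a n ↔ Encodable.decode n = some w ∧ b a w = true := by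
    intro a n w
    simp only [g, Option.mem_def, Option.bind_eq_some_iff]
    constructor
    · rintro ⟨v, hv, h⟩
      cases hbv : b a v <;> simp_all
    · rintro ⟨h, h'⟩
      exact ⟨w, h, by simp [h']⟩
  refine ⟨fun a => Nat.rfindOpt (g a), Partrec.rfindOpt hg, fun a => ?_, fun a w hw => ?_⟩
  · rw [Nat.rfindOpt_dom]
    constructor
    · rintro ⟨n, w, h⟩
      exact ⟨w, ((hmem a n w).1 h).2⟩
    · rintro ⟨w, h⟩
      exact ⟨Encodable.encode w, w, (hmem _ _ _).2 ⟨Encodable.encodek w, h⟩⟩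
  · obtain ⟨n, h⟩ := Nat.rfindOpt_spec hw
    exact ((hmem a n w).1 h).2

theorem Computable₂.rePred_exists {α β : Type*} [Primcodable α] [Primcodable β]
    {b : α → β → Bool} (hb : Computable₂ b) : REPred fun a => ∃ w, b a w = true := by
  obtain ⟨f, hf, hdom, -⟩ := hb.exists_partrec_search
  exact hf.dom_re.of_eq hdom

theorem Computable₂.exists_choice {α β : Type*} [Primcodable α] [Primcodable β]
    {b : α → β → Bool} (hb : Computable₂ b) (h : ∀ a, ∃ w, b a w = true) :
    ∃ f : α → β, Computable f ∧ ∀ a, b a (f a) = true := by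
  obtain ⟨f, hf, hdom, hspec⟩ := hb.exists_partrec_search
  have hd : ∀ a, (f a).Dom := fun a => (hdom a).2 (h a)
  exact ⟨fun a => (f a).get (hd a), hf.of_eq_tot fun a => Part.get_mem (hd a),
    fun a => hspec a _ (Part.get_mem (hd a))⟩

theorem Primrec.nat_pow_two : Primrec fun n : ℕ => 2 ^ n := by
  have h : Primrec₂ fun (_ : ℕ) (r : ℕ) => 2 * r := Primrec.nat_double.comp₂ Primrec₂.right
  refine (Primrec.nat_rec₁ 1 h).of_eq fun n => ?_
  induction n with
  | zero => rfl
  | succ n ih => simp only [ih, pow_succ]; ring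

theorem Computable.decide_nat_lt {α : Type*} [Primcodable α] {f g : α → ℕ} (hf : Computable f)
    (hg : Computable g) : Computable fun a => decide (f a < g a) :=
  (Primrec.nat_lt.decide.to_comp).comp hf hg

theorem Computable.list_decide_mem {α β : Type*} [Primcodable α] [Primcodable β]
    {l : α → List β} {b : α → β} (hl : Computable l) (hb : Computable b)
    [DecidablePred fun a => b a ∈ l a] : Computable fun a => decide (b a ∈ l a) := by
  classical
  have h : PrimrecRel fun (l : List β) (b : β) => ∃ c ∈ l, c = b :=
    PrimrecRel.exists_mem_list Primrec.eq
  exact (h.decide.to_comp.comp hl hb).of_eq fun a => by simp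

theorem Computable.two_pow {α : Type*} [Primcodable α] {f : α → ℕ} (hf : Computable f) :
    Computable fun a => 2 ^ f a :=
  Primrec.nat_pow_two.to_comp.comp hf

theorem Computable.nat_add {α : Type*} [Primcodable α] {f g : α → ℕ} (hf : Computable f)
    (hg : Computable g) : Computable fun a => f a + g a :=
  Primrec.nat_add.to_comp.comp hf hg

/-! ### Integer approximations of a computable measure. -/

namespace MLRandom

/-- All binary strings of length `m`. -/
def strings : ℕ → List (List Bool)
  | 0 => [[]]
  | m + 1 => (strings m).flatMap fun x => [false :: x, true :: x]

theorem mem_strings {m : ℕ} {x : List Bool} : x ∈ strings m ↔ x.length = m := by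
  induction m generalizing x with
  | zero => simp [strings]
  | succ m ih =>
    simp only [strings, List.mem_flatMap, ih]
    cases x with
    | nil => simp
    | cons b x => cases b <;> simp

theorem nodup_strings (m : ℕ) : (strings m).Nodup := by
  induction m with
  | zero => simp [strings]
  | succ m ih =>
    rw [strings, List.nodup_flatMap]
    refine ⟨by simp, ih.imp fun {x y} h => ?_⟩
    simp [Function.onFun, h.symm]

theorem primrec_strings : Primrec strings := by
  have h : Primrec₂ fun (_ : ℕ) (l : List (List Bool)) =>
      l.flatMap fun x => [false :: x, true :: x] := by
    refine Primrec.list_flatMap Primrec.snd ?_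
    refine Primrec.list_cons.comp (Primrec.list_cons.comp (Primrec.const false) Primrec.snd) ?_
    exact Primrec.list_cons.comp (Primrec.list_cons.comp (Primrec.const true) Primrec.snd)
      (Primrec.const [])
  refine (Primrec.nat_rec₁ [[]] h).of_eq fun n => ?_
  induction n with
  | zero => rfl
  | succ n ih => simp only [ih, strings]

/-- The sum of `a x k` over the strings `x` of length `m` with property `p`. -/
def levelSum (a : List Bool → ℕ → ℕ) (p : List Bool → Bool) (m k : ℕ) : ℕ :=
  ((strings m).map fun x => cond (p x) (a x k) 0).sum

theorem computable_levelSum {β : Type*} [Primcodable β] {a : List Bool → ℕ → ℕ}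
    (ha : Computable₂ a) {p : β → List Bool → Bool} (hp : Computable₂ p) {m k : β → ℕ}
    (hm : Computable m) (hk : Computable k) :
    Computable fun b => levelSum a (p b) (m b) (k b) := by
  refine Computable.list_sum_map (primrec_strings.to_comp.comp hm) ?_
  exact Computable.cond hp (ha.comp Computable.snd (hk.comp Computable.fst)) (Computable.const 0)

/-- `a x k` approximates `(k + 1) * P(Δ(x))` from above with error at most `3`. -/
def UpperApprox (P : Measure Seq) (a : List Bool → ℕ → ℕ) : Prop :=
  ∀ x k, P.real (cyl x) * (k + 1) ≤ a x k ∧ (a x k : ℝ) ≤ P.real (cyl x) * (k + 1) + 3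

theorem IsComputable.exists_upperApprox {P : Measure Seq} (hP : IsComputable P) :
    ∃ a, Computable₂ a ∧ UpperApprox P a := by
  obtain ⟨p, hp, h⟩ := hP
  refine ⟨fun x k => (p x (k + 1)).1.toNat * (k + 1) / ((p x (k + 1)).2 + 1) + 2, ?_, ?_⟩
  · have hq : Computable fun z : List Bool × ℕ => p z.1 (z.2 + 1) :=
      hp.comp Computable.fst (Computable.succ.comp Computable.snd)
    refine (Primrec.nat_add.to_comp).comp ?_ (Computable.const 2)
    refine (Primrec.nat_div.to_comp).comp ((Primrec.nat_mul.to_comp).comp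
      (Primrec.int_toNat.to_comp.comp (Computable.fst.comp hq))
      (Computable.succ.comp Computable.snd)) ?_
    exact Computable.succ.comp (Computable.snd.comp hq)
  · intro x k
    have hx := h x (k + 1) k.succ_pos
    set A := (p x (k + 1)).1
    set B := (p x (k + 1)).2
    set r := P.real (cyl x) with hr
    have hr0 : 0 ≤ r := measureReal_nonneg
    have hB : (0 : ℝ) < (B : ℝ) + 1 := by positivity
    have hK : (0 : ℝ) < (k : ℝ) + 1 := by positivity
    -- Since `r ≥ 0`, replacing a negative approximation by `0` cannot increase the error.
    have hx' : |r - (A.toNat : ℝ) / ((B : ℝ) + 1)| < 1 / ((k : ℝ) + 1) := by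
      push_cast at hx
      rcases le_total 0 A with hA | hA
      · have : ((A.toNat : ℤ) : ℝ) = A := by rw [Int.toNat_of_nonneg hA]
        rw [Int.cast_natCast] at this
        rwa [this]
      · rw [Int.toNat_of_nonpos hA]
        have : (A : ℝ) / ((B : ℝ) + 1) ≤ 0 :=
          div_nonpos_of_nonpos_of_nonneg (by exact_mod_cast hA) hB.le
        rw [abs_lt] at hx ⊢
        simp only [Nat.cast_zero, zero_div, sub_zero]
        exact ⟨lt_of_lt_of_le (by simpa using hK) hr0, by linarith [hx.2]⟩
    set t : ℝ := (A.toNat : ℝ) / ((B : ℝ) + 1) * (k + 1) with ht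
    have h1 : |r * (k + 1) - t| < 1 := by
      rw [ht, ← sub_mul, abs_mul, abs_of_pos hK]
      rwa [lt_div_iff₀ hK] at hx'
    have h2 : (A.toNat * (k + 1) / (B + 1) : ℕ) = ⌊t⌋₊ := by
      rw [ht, div_mul_eq_mul_div]
      have := Nat.floor_div_natCast (K := ℝ) ((A.toNat * (k + 1) : ℕ) : ℝ) (B + 1)
      push_cast at this
      rw [this]
      have h3 : (A.toNat : ℝ) * (k + 1) = ((A.toNat * (k + 1) : ℕ) : ℝ) := by push_cast; ring
      rw [h3, Nat.floor_natCast]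
    -- As `t` is within `1` of `r * (k + 1)`, adding `2` to its floor gives an upper bound that is
    -- too large by at most `3`.
    have h3 := Nat.floor_le (show 0 ≤ t by positivity)
    have h4 := Nat.lt_floor_add_one t
    rw [abs_lt] at h1
    change r * (k + 1) ≤ ((A.toNat * (k + 1) / (B + 1) + 2 : ℕ) : ℝ) ∧
      ((A.toNat * (k + 1) / (B + 1) + 2 : ℕ) : ℝ) ≤ r * (k + 1) + 3
    rw [h2]
    push_cast
    constructor <;> linarith [h1.1, h1.2]

/-! ### Cylinders, clopen sets and their measures. -/

/-- The initial segment of length `m` of a sequence. -/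
def initial (ω : Seq) (m : ℕ) : List Bool := (List.range m).map ω

@[simp] theorem length_initial (ω : Seq) (m : ℕ) : (initial ω m).length = m := by
  simp [initial]

theorem take_initial (ω : Seq) {i m : ℕ} (h : i ≤ m) : (initial ω m).take i = initial ω i := by
  rw [initial, ← List.map_take, List.take_range, min_eq_left h, initial]

theorem mem_cyl_iff {ω : Seq} {x : List Bool} : ω ∈ cyl x ↔ initial ω x.length = x := by
  constructor
  · intro h
    refine List.ext_getElem (by simp) fun i h1 h2 => ?_
    simpa [initial] using h i h2
  · intro h i hi
    have h1 : (initial ω x.length)[i]? = x[i]? := by rw [h]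
    simpa [initial, hi] using h1

theorem mem_cyl_initial (ω : Seq) (m : ℕ) : ω ∈ cyl (initial ω m) := by
  simp [mem_cyl_iff]

theorem mem_cover_iff {ω : Seq} {A : Set (List Bool)} :
    ω ∈ cover A ↔ ∃ m, initial ω m ∈ A := by
  simp only [cover, Set.mem_iUnion, exists_prop]
  constructor
  · rintro ⟨x, hx, h⟩
    exact ⟨x.length, by rwa [mem_cyl_iff.1 h]⟩
  · rintro ⟨m, h⟩
    exact ⟨_, h, mem_cyl_initial ω m⟩

theorem isOpen_cyl (x : List Bool) : IsOpen (cyl x) := by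
  have : cyl x = ⋂ i : Fin x.length, (fun ω : Seq => ω i) ⁻¹' {x[i]} := by
    ext ω
    simp only [cyl, Set.mem_ofPred_eq, Set.mem_iInter, Set.mem_preimage, Set.mem_singleton_iff]
    exact ⟨fun h i => h i i.2, fun h i hi => h ⟨i, hi⟩⟩
  rw [this]
  exact isOpen_iInter_of_finite fun i => (isOpen_discrete _).preimage (continuous_apply _)

theorem measurableSet_cyl (x : List Bool) : MeasurableSet (cyl x) := (isOpen_cyl x).measurableSet

theorem measurableSet_cover (A : Set (List Bool)) : MeasurableSet (cover A) :=
  MeasurableSet.biUnion A.to_countable fun x _ => measurableSet_cyl x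

/-- The clopen set of the sequences whose initial segment of length `m` has property `p`. -/
def clopen (p : List Bool → Bool) (m : ℕ) : Set Seq := {ω | p (initial ω m) = true}

theorem clopen_eq_biUnion (p : List Bool → Bool) (m : ℕ) :
    clopen p m = ⋃ x ∈ (strings m).toFinset.filter (fun x => p x = true), cyl x := by
  ext ω
  simp only [clopen, Set.mem_ofPred_eq, Set.mem_iUnion, Finset.mem_filter, List.mem_toFinset,
    mem_strings, exists_prop]
  constructor
  · exact fun h => ⟨_, ⟨by simp, h⟩, mem_cyl_initial ω m⟩
  · rintro ⟨x, ⟨rfl, h⟩, hx⟩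
    rwa [mem_cyl_iff.1 hx]

theorem measurableSet_clopen (p : List Bool → Bool) (m : ℕ) : MeasurableSet (clopen p m) := by
  rw [clopen_eq_biUnion]
  exact Finset.measurableSet_biUnion _ fun x _ => measurableSet_cyl x

theorem compl_clopen (p : List Bool → Bool) (m : ℕ) :
    (clopen p m)ᶜ = clopen (fun x => !p x) m := by
  ext ω; simp [clopen]

theorem measureReal_clopen (P : Measure Seq) [IsFiniteMeasure P] (p : List Bool → Bool) (m : ℕ) :
    P.real (clopen p m) = ∑ x ∈ (strings m).toFinset.filter (fun x => p x = true),
      P.real (cyl x) := by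
  rw [clopen_eq_biUnion, measureReal_biUnion_finset _ fun x _ => measurableSet_cyl x]
  intro x hx y hy hxy
  rw [Function.onFun, Set.disjoint_left]
  intro ω h1 h2
  simp only [Finset.coe_filter, List.mem_toFinset, mem_strings, Set.mem_ofPred_eq] at hx hy
  rw [mem_cyl_iff, hx.1] at h1
  rw [mem_cyl_iff, hy.1] at h2
  exact hxy (h1.symm.trans h2)

theorem levelSum_eq (a : List Bool → ℕ → ℕ) (p : List Bool → Bool) (m k : ℕ) :
    levelSum a p m k = ∑ x ∈ (strings m).toFinset.filter (fun x => p x = true), a x k := by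
  rw [Finset.sum_filter, List.sum_toFinset _ (nodup_strings m), levelSum]
  congr 1
  refine List.map_congr_left fun x _ => ?_
  cases p x <;> simp

/-- This makes the bound semi-decidable. The sums approximate from above, so one successful `k`
proves the inequality; the error per string is at most `3 / (k + 1)`, so a strict inequality is
eventually detected. -/
theorem UpperApprox.measureReal_clopen_lt_iff {P : Measure Seq} [IsFiniteMeasure P]
    {a : List Bool → ℕ → ℕ} (ha : UpperApprox P a) (p : List Bool → Bool) (m n : ℕ) :
    P.real (clopen p m) < (1 / 2 : ℝ) ^ n ↔ ∃ k, levelSum a p m k * 2 ^ n < k + 1 := by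
  have hpow : (0 : ℝ) < 2 ^ n := by positivity
  rw [one_div, inv_pow, ← one_div, lt_div_iff₀ hpow]
  set s := (strings m).toFinset.filter (fun x => p x = true) with hs
  constructor
  · intro h
    -- With such a `k` the total error `3 * s.card`, scaled by `2 ^ n`, is less than the slack times
    -- `k + 1`.
    obtain ⟨k, hk⟩ := exists_nat_gt (3 * s.card * 2 ^ n / (1 - P.real (clopen p m) * 2 ^ n))
    rw [div_lt_iff₀ (by linarith)] at hk
    refine ⟨k, ?_⟩
    have h1 : (levelSum a p m k : ℝ) ≤ P.real (clopen p m) * (k + 1) + 3 * s.card := by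
      rw [levelSum_eq, measureReal_clopen, ← hs, Finset.sum_mul, Nat.cast_sum]
      refine (Finset.sum_le_sum fun x _ => (ha x k).2).trans ?_
      rw [Finset.sum_add_distrib, Finset.sum_const, nsmul_eq_mul, mul_comm (s.card : ℝ)]
    have h2 := mul_le_mul_of_nonneg_right h1 hpow.le
    have h3 : (levelSum a p m k : ℝ) * 2 ^ n < k + 1 := by nlinarith
    exact_mod_cast h3
  · rintro ⟨k, hk⟩
    have h3 : (levelSum a p m k : ℝ) * 2 ^ n < k + 1 := by exact_mod_cast hk
    have h1 : P.real (clopen p m) * (k + 1) ≤ levelSum a p m k := by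
      rw [levelSum_eq, measureReal_clopen, Finset.sum_mul, Nat.cast_sum]
      exact Finset.sum_le_sum fun x _ => (ha x k).1
    have h2 := mul_le_mul_of_nonneg_right h1 hpow.le
    have hk0 : (0 : ℝ) < k + 1 := by positivity
    by_contra! hc
    nlinarith

theorem measureReal_lt_of_le {P : Measure Seq} [IsFiniteMeasure P] {A : Set Seq} {n : ℕ}
    (h : P A ≤ 2⁻¹ ^ (n + 1)) : P.real A < (1 / 2 : ℝ) ^ n := by
  have h1 : P.real A ≤ (1 / 2 : ℝ) ^ (n + 1) := by
    have := ENNReal.toReal_mono (by simp) h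
    simpa [measureReal_def] using this
  have : (0 : ℝ) < (1 / 2) ^ n := by positivity
  rw [pow_succ] at h1
  linarith

theorem measure_le_of_measureReal_lt {P : Measure Seq} [IsFiniteMeasure P] {A : Set Seq} {n : ℕ}
    (h : P.real A < (1 / 2 : ℝ) ^ n) : P A ≤ 2⁻¹ ^ n := by
  rw [← ofReal_measureReal]
  refine (ENNReal.ofReal_le_ofReal h.le).trans_eq ?_
  rw [ENNReal.ofReal_pow (by norm_num), one_div, ENNReal.ofReal_inv_of_pos (by norm_num)]
  simp

theorem tsum_pow_add (n : ℕ) : ∑' i : ℕ, (2⁻¹ : ENNReal) ^ (n + i + 1) = 2⁻¹ ^ n := by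
  have : ∀ i : ℕ, (2⁻¹ : ENNReal) ^ (n + i + 1) = 2⁻¹ ^ (n + 1) * 2⁻¹ ^ i := fun i => by
    rw [← pow_add]; congr 1; omega
  simp_rw [this]
  rw [ENNReal.tsum_mul_left, ENNReal.tsum_geometric_two, pow_succ, mul_assoc,
    ENNReal.inv_mul_cancel (by norm_num) (by norm_num), mul_one]

/-! ### Enumeration of r.e. sets and the universal test. -/

/-- Some prefix of `x` is accepted, within `x.length` steps, into the level `N` of the
recursively enumerable set with index `e`. -/
def reach (e N : ℕ) (x : List Bool) : Bool :=
  decide (∃ i < x.length + 1,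
    (Nat.Partrec.Code.evaln x.length (Denumerable.ofNat Nat.Partrec.Code e)
      (Encodable.encode (N, x.take i))).isSome = true)

theorem reach_iff {e N : ℕ} {ω : Seq} {m : ℕ} : reach e N (initial ω m) = true ↔
    ∃ i ≤ m, (Nat.Partrec.Code.evaln m (Denumerable.ofNat Nat.Partrec.Code e)
      (Encodable.encode (N, initial ω i))).isSome = true := by
  simp only [reach, decide_eq_true_eq, length_initial, Nat.lt_succ_iff]
  refine exists_congr fun i => and_congr_right fun h => ?_
  rw [take_initial ω h]

theorem primrec_reach :
    Primrec fun q : (ℕ × ℕ) × List Bool => reach q.1.1 q.1.2 q.2 := by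
  have hR : PrimrecRel fun (i : ℕ) (q : (ℕ × ℕ) × List Bool) =>
      (Nat.Partrec.Code.evaln q.2.length (Denumerable.ofNat Nat.Partrec.Code q.1.1)
        (Encodable.encode (q.1.2, q.2.take i))).isSome = true := by
    have hq : Primrec fun z : ℕ × ((ℕ × ℕ) × List Bool) => z.2.2 :=
      Primrec.snd.comp Primrec.snd
    have hev : Primrec fun z : ℕ × ((ℕ × ℕ) × List Bool) =>
        Nat.Partrec.Code.evaln z.2.2.length (Denumerable.ofNat Nat.Partrec.Code z.2.1.1)
          (Encodable.encode (z.2.1.2, z.2.2.take z.1)) := by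
      refine Nat.Partrec.Code.primrec_evaln.comp (Primrec.pair (Primrec.pair
        (Primrec.list_length.comp hq) ?_) ?_)
      · exact (Primrec.ofNat Nat.Partrec.Code).comp
          (Primrec.fst.comp (Primrec.fst.comp Primrec.snd))
      · exact Primrec.encode.comp (Primrec.pair
          (Primrec.snd.comp (Primrec.fst.comp Primrec.snd))
          (Primrec.list_take.comp Primrec.fst hq))
    exact Primrec.eq.comp (Primrec.option_isSome.comp hev) (Primrec.const true)
  have hlen : Primrec fun q : (ℕ × ℕ) × List Bool => q.2.length + 1 :=
    Primrec.succ.comp (Primrec.list_length.comp Primrec.snd)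
  have h := (PrimrecRel.exists_mem_list hR).comp (Primrec.list_range.comp hlen) Primrec.id
  refine (h.of_eq fun q => ?_).decide
  simp only [List.mem_range, id]

theorem computable_reach {β : Type*} [Primcodable β] {e N : β → ℕ} {x : β → List Bool}
    (he : Computable e) (hN : Computable N) (hx : Computable x) :
    Computable fun b => reach (e b) (N b) (x b) :=
  primrec_reach.to_comp.comp ((he.pair hN).pair hx)

theorem monotone_clopen_reach (e N : ℕ) : Monotone (clopen (reach e N)) := by
  intro m m' hm ω h
  obtain ⟨i, hi, h⟩ := reach_iff.1 h
  obtain ⟨v, hv⟩ := Option.isSome_iff_exists.1 h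
  exact reach_iff.2 ⟨i, hi.trans hm,
    Option.isSome_iff_exists.2 ⟨v, Nat.Partrec.Code.evaln_mono hm hv⟩⟩

/-- Membership in `V` is halting of a code. Letting the length of the string bound both the prefixes
tried and the running time turns the open level into an increasing union of clopen stages. -/
theorem exists_cover_level_eq {V : Set (ℕ × List Bool)} (hV : REPred fun q => q ∈ V) :
    ∃ e, ∀ N, cover (level V N) = ⋃ m, clopen (reach e N) m := by
  obtain ⟨c, hc⟩ := Nat.Partrec.Code.exists_code.1 hV
  have hmem : ∀ q, q ∈ V ↔ ∃ k, (Nat.Partrec.Code.evaln k c (Encodable.encode q)).isSome := by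
    intro q
    have h1 : q ∈ V ↔ (Nat.Partrec.Code.eval c (Encodable.encode q)).Dom := by
      rw [hc]; simp [Part.assert]
    rw [h1, Part.dom_iff_mem]
    simp only [Nat.Partrec.Code.evaln_complete, Option.isSome_iff_exists, Option.mem_def]
    exact exists_comm
  refine ⟨Encodable.encode c, fun N => ?_⟩
  ext ω
  simp only [mem_cover_iff, Set.mem_iUnion]
  constructor
  · rintro ⟨i, h⟩
    obtain ⟨k, hk⟩ := (hmem _).1 h
    obtain ⟨v, hv⟩ := Option.isSome_iff_exists.1 hk
    refine ⟨max i k, reach_iff.2 ⟨i, le_max_left _ _, ?_⟩⟩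
    rw [Denumerable.ofNat_encode]
    exact Option.isSome_iff_exists.2 ⟨v, Nat.Partrec.Code.evaln_mono (le_max_right _ _) hv⟩
  · rintro ⟨m, h⟩
    obtain ⟨i, -, h⟩ := reach_iff.1 h
    rw [Denumerable.ofNat_encode] at h
    exact ⟨i, (hmem _).2 ⟨m, h⟩⟩

/-- The union of the enumerated clopen sets as long as their measure stays below `2⁻ᴺ`. -/
def trimmed (P : Measure Seq) (e N : ℕ) : Set Seq :=
  ⋃ m : {m // P.real (clopen (reach e N) m) < (1 / 2 : ℝ) ^ N}, clopen (reach e N) m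

/-- The stages increase, so continuity from below applies. The bound holds for every index `e`,
whether or not it codes a test. -/
theorem measure_trimmed_le (P : Measure Seq) [IsFiniteMeasure P] (e N : ℕ) :
    P (trimmed P e N) ≤ 2⁻¹ ^ N := by
  rw [trimmed, Directed.measure_iUnion]
  · exact iSup_le fun m => measure_le_of_measureReal_lt m.2
  · exact Monotone.directed_le fun m m' h => monotone_clopen_reach e N h

/-- A universal test, built from an upper approximation `a` of the measure. -/
def universalTest (a : List Bool → ℕ → ℕ) : Set (ℕ × List Bool) :=
  {q | ∃ w : ℕ × ℕ × ℕ,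
    (reach w.2.1 (q.1 + w.1 + w.2.1 + 3) q.2 &&
      decide (levelSum a (reach w.2.1 (q.1 + w.1 + w.2.1 + 3)) q.2.length w.2.2 *
        2 ^ (q.1 + w.1 + w.2.1 + 3) < w.2.2 + 1)) = true}

theorem rePred_universalTest {a : List Bool → ℕ → ℕ} (ha : Computable₂ a) :
    REPred fun q => q ∈ universalTest a := by
  let b : ℕ × List Bool → ℕ × ℕ × ℕ → Bool := fun q w =>
    reach w.2.1 (q.1 + w.1 + w.2.1 + 3) q.2 &&
      decide (levelSum a (reach w.2.1 (q.1 + w.1 + w.2.1 + 3)) q.2.length w.2.2 *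
        2 ^ (q.1 + w.1 + w.2.1 + 3) < w.2.2 + 1)
  suffices hb : Computable₂ b from hb.rePred_exists
  have he : Computable fun z : (ℕ × List Bool) × (ℕ × ℕ × ℕ) => z.2.2.1 :=
    Computable.fst.comp (Computable.snd.comp Computable.snd)
  have hk : Computable fun z : (ℕ × List Bool) × (ℕ × ℕ × ℕ) => z.2.2.2 :=
    Computable.snd.comp (Computable.snd.comp Computable.snd)
  have hx : Computable fun z : (ℕ × List Bool) × (ℕ × ℕ × ℕ) => z.1.2 :=
    Computable.snd.comp Computable.fst
  have hN : Computable fun z : (ℕ × List Bool) × (ℕ × ℕ × ℕ) => z.1.1 + z.2.1 + z.2.2.1 + 3 :=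
    (Primrec.nat_add.comp (Primrec.nat_add.comp (Primrec.nat_add.comp
      (Primrec.fst.comp Primrec.fst) (Primrec.fst.comp Primrec.snd))
      (Primrec.fst.comp (Primrec.snd.comp Primrec.snd))) (Primrec.const 3)).to_comp
  have hr : Computable₂ fun (z : (ℕ × List Bool) × (ℕ × ℕ × ℕ)) (x : List Bool) =>
      reach z.2.2.1 (z.1.1 + z.2.1 + z.2.2.1 + 3) x :=
    computable_reach (he.comp Computable.fst) (hN.comp Computable.fst) Computable.snd
  have hsum := computable_levelSum ha hr (Computable.list_length.comp hx) hk
  have hpow := hN.two_pow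
  have hprod := Primrec.nat_mul.to_comp.comp hsum hpow
  have hlt := Computable.decide_nat_lt hprod (Computable.succ.comp hk)
  have hr' := computable_reach he hN hx
  exact Primrec.and.to_comp.comp hr' hlt

theorem cover_level_universalTest {P : Measure Seq} [IsFiniteMeasure P]
    {a : List Bool → ℕ → ℕ} (ha : UpperApprox P a) (n : ℕ) :
    cover (level (universalTest a) n) = ⋃ (i : ℕ) (e : ℕ), trimmed P e (n + i + e + 3) := by
  ext ω
  simp only [mem_cover_iff, level, universalTest, trimmed, Set.mem_ofPred_eq, Set.mem_iUnion,
    Bool.and_eq_true, decide_eq_true_eq, length_initial]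
  constructor
  · rintro ⟨m, ⟨i, e, k⟩, h1, h2⟩
    exact ⟨i, e, ⟨m, (ha.measureReal_clopen_lt_iff _ _ _).2 ⟨k, h2⟩⟩, h1⟩
  · rintro ⟨i, e, ⟨m, hm⟩, h⟩
    obtain ⟨k, hk⟩ := (ha.measureReal_clopen_lt_iff _ _ _).1 hm
    exact ⟨m, ⟨i, e, k⟩, h, hk⟩

/-- The union over `i` forces nested levels, which an arbitrary index `e` need not have. Summing `2
^ (-(n + i + e + 3))` over `e` and `i` gives `2 ^ (-(n + 1))`, which leaves room for the strict
bound. A genuine test with index `e` is never cut off, so it is dominated with constant `e + 3`,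
through `i = 0`. -/
theorem isUniversalTest_universalTest {P : Measure Seq} [IsFiniteMeasure P]
    {a : List Bool → ℕ → ℕ} (hc : Computable₂ a) (ha : UpperApprox P a) :
    IsUniversalTest P (universalTest a) where
  isTest :=
    { re := rePred_universalTest hc
      antitone := fun n => by
        rw [cover_level_universalTest ha, cover_level_universalTest ha]
        refine Set.iUnion_subset fun i => ?_
        refine Set.subset_iUnion_of_subset (i + 1) ?_
        rw [show n + 1 + i = n + (i + 1) by omega]
      measure_lt := fun n => by
        refine measureReal_lt_of_le ?_
        rw [cover_level_universalTest ha]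
        calc P (⋃ (i : ℕ) (e : ℕ), trimmed P e (n + i + e + 3))
            ≤ ∑' (i : ℕ) (e : ℕ), P (trimmed P e (n + i + e + 3)) :=
              (measure_iUnion_le _).trans (ENNReal.tsum_le_tsum fun i => measure_iUnion_le _)
          _ ≤ ∑' (i : ℕ) (e : ℕ), (2⁻¹ : ENNReal) ^ (n + i + 2 + e + 1) := by
              refine ENNReal.tsum_le_tsum fun i => ENNReal.tsum_le_tsum fun e => ?_
              rw [show n + i + 2 + e + 1 = n + i + e + 3 by omega]
              exact measure_trimmed_le P e _
          _ = ∑' i : ℕ, (2⁻¹ : ENNReal) ^ (n + 1 + i + 1) := by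
              refine tsum_congr fun i => ?_
              rw [tsum_pow_add, show n + i + 2 = n + 1 + i + 1 by omega]
          _ ≤ 2⁻¹ ^ (n + 1) := (tsum_pow_add _).le }
  dominates := fun V hV => by
    obtain ⟨e, he⟩ := exists_cover_level_eq hV.re
    refine ⟨e + 3, fun n => ?_⟩
    have hV' := he (n + (e + 3))
    rw [cover_level_universalTest ha, hV']
    refine Set.iUnion_subset fun m => ?_
    refine Set.subset_iUnion_of_subset 0 (Set.subset_iUnion_of_subset e ?_)
    rw [show n + 0 + e + 3 = n + (e + 3) by omega, trimmed]
    refine Set.subset_iUnion_of_subset ⟨m, ?_⟩ le_rfl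
    refine lt_of_le_of_lt (measureReal_mono ?_) (hV.measure_lt (n + (e + 3)))
    rw [hV']
    exact Set.subset_iUnion _ m

theorem IsComputable.exists_isUniversalTest {P : Measure Seq} [IsFiniteMeasure P]
    (hP : IsComputable P) : ∃ U, IsUniversalTest P U := by
  obtain ⟨a, hc, ha⟩ := hP.exists_upperApprox
  exact ⟨_, isUniversalTest_universalTest hc ha⟩

theorem IsTest.measure_testLimit {P : Measure Seq} [IsFiniteMeasure P] {U : Set (ℕ × List Bool)}
    (hU : IsTest P U) : P (testLimit U) = 0 := by
  rw [← nonpos_iff_eq_zero]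
  refine ge_of_tendsto' (f := fun n : ℕ => (2⁻¹ : ENNReal) ^ (n + 1)) (x := Filter.atTop)
    ((ENNReal.tendsto_pow_atTop_nhds_zero_of_lt_one (by norm_num)).comp
      (Filter.tendsto_add_atTop_nat 1)) fun n => ?_
  refine (measure_mono ?_).trans (measure_le_of_measureReal_lt (hU.measure_lt (n + 1)))
  exact Set.iInter₂_subset (n + 1) (by omega)

theorem measurableSet_testLimit (U : Set (ℕ × List Bool)) : MeasurableSet (testLimit U) :=
  MeasurableSet.iInter fun _ => MeasurableSet.iInter fun _ => measurableSet_cover _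

/-! ### Separating clopen sets and the effective Borel–Cantelli test. -/

/-- Outer regularity encloses a `P`-null set of full `Q`-measure in an open set of small
`P`-measure; that open set is an increasing union of clopen sets, one of which carries almost all of
`Q`. The list `l` is a finite code for the clopen set, so that it can be searched for. -/
theorem exists_clopen_of_mutuallySingular {P Q : Measure Seq} [IsProbabilityMeasure P]
    [IsProbabilityMeasure Q] (h : P.MutuallySingular Q) {ε : ℝ} (hε : 0 < ε) :
    ∃ (m : ℕ) (l : List (List Bool)), P.real (clopen (fun x => decide (x ∈ l)) m) < ε ∧
      Q.real (clopen (fun x => !decide (x ∈ l)) m) < ε := by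
  classical
  obtain ⟨A, hA, hPA, hQA⟩ := h
  obtain ⟨O, hAO, hO, hPO⟩ := A.exists_isOpen_lt_of_lt (μ := P) (ENNReal.ofReal ε)
    (by rw [hPA]; exact ENNReal.ofReal_pos.2 hε)
  let p : List Bool → Bool := fun x => decide (cyl x ⊆ O)
  have hp : ∀ x, p x = true ↔ cyl x ⊆ O := fun x => by simp [p]
  have hsub : ∀ m, clopen p m ⊆ O := fun m ω hω => (hp _).1 hω (mem_cyl_initial ω m)
  have hmono : Monotone (clopen p) := by
    intro m m' hm ω hω
    refine (hp _).2 (Set.Subset.trans ?_ ((hp _).1 hω))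
    intro ω' h'
    rw [mem_cyl_iff, length_initial] at h' ⊢
    rw [← take_initial ω' hm, h', take_initial ω hm]
  have hunion : ⋃ m, clopen p m = O := by
    refine Set.Subset.antisymm (Set.iUnion_subset hsub) fun ω hω => ?_
    obtain ⟨I, u, hu, hI⟩ := isOpen_pi_iff.1 hO ω hω
    refine Set.mem_iUnion.2 ⟨I.sup id + 1, (hp _).2 fun ω' h' => hI ?_⟩
    intro i hi
    have hlt : i < I.sup id + 1 := Nat.lt_succ_of_le (Finset.le_sup (f := id) hi)
    have h1 : ω' i = ω i := by
      have := h' i (by simpa using hlt)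
      simpa [initial] using this
    rw [h1]
    exact (hu i hi).2
  have hQO : Q O = 1 := by
    rw [← prob_compl_eq_zero_iff hO.measurableSet]
    exact measure_mono_null (Set.compl_subset_compl.2 hAO) hQA
  have hlim : Filter.Tendsto (fun m => Q.real (clopen p m)) Filter.atTop (nhds 1) := by
    have h1 := tendsto_measure_iUnion_atTop (μ := Q) hmono
    rw [hunion, hQO] at h1
    exact (ENNReal.tendsto_toReal ENNReal.one_ne_top).comp h1
  obtain ⟨m, hm⟩ := (hlim.eventually (lt_mem_nhds (show 1 - ε < 1 by linarith))).exists
  let l := (strings m).filter p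
  have hl : clopen (fun x => decide (x ∈ l)) m = clopen p m := by
    ext ω
    simp [clopen, l, mem_strings]
  refine ⟨m, l, ?_, ?_⟩
  · rw [hl]
    have h2 := (measure_mono (hsub m)).trans_lt hPO
    rw [measureReal_def]
    exact ENNReal.toReal_lt_of_lt_ofReal h2
  · rw [← compl_clopen, hl, probReal_compl_eq_one_sub (measurableSet_clopen _ _)]
    linarith

/-- The test whose `n`-th level is the union of the clopen sets with index at least `n`. -/
theorem isTest_of_clopen {P : Measure Seq} [IsFiniteMeasure P] {p : ℕ → List Bool → Bool}
    {m : ℕ → ℕ} (hp : Computable₂ p) (hm : Computable m)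
    (h : ∀ n, P.real (clopen (p n) (m n)) < (1 / 2 : ℝ) ^ (n + 2)) :
    ∃ U, IsTest P U ∧ ∀ n, cover (level U n) = ⋃ i, clopen (p (n + i)) (m (n + i)) := by
  let b : ℕ × List Bool → ℕ → Bool := fun q i =>
    decide (q.2.length = m (q.1 + i)) && p (q.1 + i) q.2
  have hb : Computable₂ b := by
    have hx : Computable fun z : (ℕ × List Bool) × ℕ => z.1.2 :=
      Computable.snd.comp Computable.fst
    have hN : Computable fun z : (ℕ × List Bool) × ℕ => z.1.1 + z.2 :=
      Primrec.nat_add.to_comp.comp (Computable.fst.comp Computable.fst) Computable.snd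
    exact Primrec.and.to_comp.comp ((Primrec.eq (α := ℕ)).decide.to_comp.comp
      (Computable.list_length.comp hx) (hm.comp hN)) (hp.comp hN hx)
  let U : Set (ℕ × List Bool) := {q | ∃ i, b q i = true}
  have hU : ∀ n, cover (level U n) = ⋃ i, clopen (p (n + i)) (m (n + i)) := by
    intro n
    ext ω
    simp only [mem_cover_iff, level, U, b, Set.mem_ofPred_eq, Set.mem_iUnion, Bool.and_eq_true,
      decide_eq_true_eq, length_initial, clopen]
    constructor
    · rintro ⟨k, i, rfl, h⟩
      exact ⟨i, h⟩
    · rintro ⟨i, h⟩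
      exact ⟨_, i, rfl, h⟩
  refine ⟨U, ⟨hb.rePred_exists, fun n => ?_, fun n => measureReal_lt_of_le ?_⟩, hU⟩
  · rw [hU, hU]
    refine Set.iUnion_subset fun i => Set.subset_iUnion_of_subset (i + 1) ?_
    rw [show n + 1 + i = n + (i + 1) by omega]
  · rw [hU]
    -- The tail sums to `2 ^ (-(n + 1))`; the exponent `n + 2` in `h` supplies the factor `1 / 2`
    -- spent on strictness.
    refine (measure_iUnion_le _).trans ((ENNReal.tsum_le_tsum fun i => ?_).trans
      (tsum_pow_add (n + 1)).le)
    rw [show n + 1 + i + 1 = n + i + 2 by omega]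
    exact measure_le_of_measureReal_lt (h _)

/-- The search runs over a clopen set together with certificates `k`, `k'` for both bounds. Mutual
singularity serves only to show that it halts. -/
theorem exists_computable_clopen {P Q : Measure Seq} [IsProbabilityMeasure P]
    [IsProbabilityMeasure Q] (hP : IsComputable P) (hQ : IsComputable Q)
    (h : P.MutuallySingular Q) :
    ∃ (p : ℕ → List Bool → Bool) (m : ℕ → ℕ), Computable₂ p ∧ Computable m ∧ ∀ n,
      P.real (clopen (p n) (m n)) < (1 / 2 : ℝ) ^ (n + 2) ∧
      Q.real (clopen (fun x => !p n x) (m n)) < (1 / 2 : ℝ) ^ (n + 2) := by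
  obtain ⟨a, ha, hPa⟩ := hP.exists_upperApprox
  obtain ⟨b, hb, hQb⟩ := hQ.exists_upperApprox
  let test : ℕ → (ℕ × List (List Bool)) × (ℕ × ℕ) → Bool := fun n w =>
    decide (levelSum a (fun x => decide (x ∈ w.1.2)) w.1.1 w.2.1 * 2 ^ (n + 2) < w.2.1 + 1) &&
    decide (levelSum b (fun x => !decide (x ∈ w.1.2)) w.1.1 w.2.2 * 2 ^ (n + 2) < w.2.2 + 1)
  have htest : Computable₂ test := by
    have hl : Computable fun z : ℕ × ((ℕ × List (List Bool)) × (ℕ × ℕ)) => z.2.1.2 :=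
      Computable.snd.comp (Computable.fst.comp Computable.snd)
    have hm : Computable fun z : ℕ × ((ℕ × List (List Bool)) × (ℕ × ℕ)) => z.2.1.1 :=
      Computable.fst.comp (Computable.fst.comp Computable.snd)
    have hk : Computable fun z : ℕ × ((ℕ × List (List Bool)) × (ℕ × ℕ)) => z.2.2.1 :=
      Computable.fst.comp (Computable.snd.comp Computable.snd)
    have hk' : Computable fun z : ℕ × ((ℕ × List (List Bool)) × (ℕ × ℕ)) => z.2.2.2 :=
      Computable.snd.comp (Computable.snd.comp Computable.snd)
    have hN : Computable fun z : ℕ × ((ℕ × List (List Bool)) × (ℕ × ℕ)) => z.1 + 2 :=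
      Computable.nat_add Computable.fst (Computable.const 2)
    have hpow := hN.two_pow
    have hmem : Computable₂ fun (z : ℕ × ((ℕ × List (List Bool)) × (ℕ × ℕ))) (x : List Bool) =>
        decide (x ∈ z.2.1.2) :=
      Computable.list_decide_mem (hl.comp Computable.fst) Computable.snd
    have hnot : Computable₂ fun (z : ℕ × ((ℕ × List (List Bool)) × (ℕ × ℕ))) (x : List Bool) =>
        !decide (x ∈ z.2.1.2) := Primrec.not.to_comp.comp hmem
    have hlt := Computable.decide_nat_lt (Primrec.nat_mul.to_comp.comp
      (computable_levelSum ha hmem hm hk) hpow) (Computable.succ.comp hk)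
    have hlt' := Computable.decide_nat_lt (Primrec.nat_mul.to_comp.comp
      (computable_levelSum hb hnot hm hk') hpow) (Computable.succ.comp hk')
    exact Primrec.and.to_comp.comp hlt hlt'
  have hex : ∀ n, ∃ w, test n w = true := by
    intro n
    obtain ⟨m, l, h1, h2⟩ := exists_clopen_of_mutuallySingular h
      (show (0 : ℝ) < (1 / 2) ^ (n + 2) by positivity)
    obtain ⟨k, hk⟩ := (hPa.measureReal_clopen_lt_iff _ _ _).1 h1
    obtain ⟨k', hk'⟩ := (hQb.measureReal_clopen_lt_iff _ _ _).1 h2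
    refine ⟨((m, l), (k, k')), ?_⟩
    simp only [test, Bool.and_eq_true, decide_eq_true_eq]
    exact ⟨hk, hk'⟩
  obtain ⟨f, hf, hspec⟩ := htest.exists_choice hex
  refine ⟨fun n x => decide (x ∈ (f n).1.2), fun n => (f n).1.1, ?_,
    Computable.fst.comp (Computable.fst.comp hf), fun n => ?_⟩
  · exact Computable.list_decide_mem
      (Computable.snd.comp (Computable.fst.comp (hf.comp Computable.fst))) Computable.snd
  · have := hspec n
    simp only [test, Bool.and_eq_true, decide_eq_true_eq] at this
    exact ⟨(hPa.measureReal_clopen_lt_iff _ _ _).2 ⟨_, this.1⟩,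
      (hQb.measureReal_clopen_lt_iff _ _ _).2 ⟨_, this.2⟩⟩

/-! ### The two implications. -/

theorem notMem_randomSet {P : Measure Seq} {U : Set (ℕ × List Bool)} (hU : IsTest P U) {ω : Seq}
    (h : ∀ n, ω ∈ cover (level U n)) : ω ∉ randomSet P := by
  rintro ⟨T, hT, hω⟩
  exact hω (testLimit_subset hT hU (Set.mem_iInter₂.2 fun n _ => h n))

theorem randomSet_inter_eq_empty {P Q : Measure Seq} [IsProbabilityMeasure P]
    [IsProbabilityMeasure Q] (hP : IsComputable P) (hQ : IsComputable Q)
    (h : P.MutuallySingular Q) : randomSet P ∩ randomSet Q = ∅ := by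
  obtain ⟨p, m, hp, hm, hpm⟩ := exists_computable_clopen hP hQ h
  obtain ⟨U, hU, hUc⟩ := isTest_of_clopen hp hm fun n => (hpm n).1
  obtain ⟨V, hV, hVc⟩ := isTest_of_clopen (p := fun n x => !p n x)
    (Primrec.not.to_comp.comp hp) hm fun n => (hpm n).2
  refine Set.eq_empty_of_forall_notMem fun ω ⟨h1, h2⟩ => ?_
  by_cases hω : ∀ n, ω ∈ cover (level U n)
  · exact notMem_randomSet hU hω h1
  · push Not at hω
    obtain ⟨n, hn⟩ := hω
    -- Here `ω` avoids all clopen sets of index at least `n`, so the complement of index `k + n`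
    -- puts it in level `k` of `V`.
    refine notMem_randomSet hV (fun k => ?_) h2
    rw [hVc]
    refine Set.mem_iUnion.2 ⟨n, ?_⟩
    rw [← compl_clopen]
    intro hc
    rw [hUc] at hn
    exact hn (Set.mem_iUnion.2 ⟨k, by rwa [add_comm n k]⟩)

/-- The separating set is `testLimit U`: a point outside both limits would be random for both
measures. -/
theorem mutuallySingular_of_randomSet_inter {P Q : Measure Seq} [IsFiniteMeasure P]
    [IsFiniteMeasure Q] (hP : IsComputable P) (hQ : IsComputable Q)
    (h : randomSet P ∩ randomSet Q = ∅) : P.MutuallySingular Q := by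
  obtain ⟨U, hU⟩ := hP.exists_isUniversalTest
  obtain ⟨V, hV⟩ := hQ.exists_isUniversalTest
  refine ⟨testLimit U, measurableSet_testLimit U, hU.isTest.measure_testLimit, ?_⟩
  refine measure_mono_null (fun ω hω => ?_) hV.isTest.measure_testLimit
  by_contra hc
  rw [randomSet_eq hU, randomSet_eq hV] at h
  exact Set.notMem_empty ω (h ▸ ⟨hω, hc⟩)

end MLRandom

theorem mainTheorem3 (P Q : MeasureTheory.Measure MLRandom.Seq)
    [MeasureTheory.IsProbabilityMeasure P] [MeasureTheory.IsProbabilityMeasure Q]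
    (hP : MLRandom.IsComputable P) (hQ : MLRandom.IsComputable Q) :
    MLRandom.randomSet P ∩ MLRandom.randomSet Q = ∅ ↔
      MeasureTheory.Measure.MutuallySingular P Q :=
  ⟨MLRandom.mutuallySingular_of_randomSet_inter hP hQ,
    MLRandom.randomSet_inter_eq_empty hP hQ⟩
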